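/- Let \(\Gamma\subset E(d)=\mathbb R^d\rtimes O(d)\) be a crystallographic group (a discrete subgroup whose orbit space \(\mathbb R^d/\Gamma\) is compact), with translation lattice \(\Pi=\Gamma\cap\mathbb R^d\) and point group \(P=\Gamma/\Pi\), regarded as a discrete group. Let \(T_\Pi=\mathbb R^d/\Pi\), and let \(P\) act on \(T_\Pi\) by \(\rho(p)[v]=[A_pv+a_p]\), where \(x\mapsto A_px+a_p\) is any representative of \(p\) in \(\Gamma\). Let \(\pi_Q:Q\to X\) be a smooth principal \(P\)-bundle over a smooth manifold \(X\) (finite-dimensional, without boundary), and let \[ \pi_Y:Y_\Pi=Q\times_PT_\Pi=(Q\times T_\Pi)/\bigl((q,\tau)\sim(qp,\rho(p^{-1})\tau)\bigr)\to X,\qquad \pi_Y([q,\tau])=\pi_Q(q), \] be the associated bundle, with vertical bundle \(VY_\Pi=\ker T\pi_Y\). Each smooth section \(z_\alpha:U_\alpha\to Q\) over an open set \(U_\alpha\subset X\) gives a local trivialization \(\psi_\alpha:\pi_Y^{-1}(U_\alpha)\to U_\alpha\times T_\Pi\), \(\psi_\alpha([z_\alpha(x),\tau])=(x,\tau)\);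 such \(U_\alpha\) cover \(X\). Let \(H_\alpha\subset TY_\Pi|_{\pi_Y^{-1}(U_\alpha)}\) be the subbundle that corresponds under \(\psi_\alpha\) to \(TU_\alpha\oplus 0\subset T(U_\alpha\times T_\Pi)=TU_\alpha\oplus TT_\Pi\). Then \(H_\alpha\) and \(H_\beta\) agree over \(U_\alpha\cap U_\beta\) for any two local sections \(z_\alpha,z_\beta\), and there is a smooth subbundle \(HY_\Pi\subset TY_\Pi\) of rank \(\dim X\) which restricts to \(H_\alpha\) for every local section \(z_\alpha\), and which is the only family of subspaces of the tangent spaces that restricts to \(H_\alpha\) for all members of any given family of local sections whose domains cover \(X\); thus it depends only on \(Q\) and \(\rho\). It satisfies \[ TY_\Pi=HY_\Pi\oplus VY_\Pi, \] it is involutive (Lie brackets of smooth local vector fields with values in \(HY_\Pi\) have values in \(HY_\Pi\)), and it is integrable (around each point of \(Y_\Pi\) there is a smooth chart in which \(HY_\Pi\) is a constant linear subspace). That is, \(HY_\Pi\) is a flat Ehresmann connection on \(Y_\Pi\to X\), canonical relative to \(Q\). -/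

import Mathlib

open Set Filter Topology
open scoped Manifold ContDiff

noncomputable section

/-! Smooth structure on the target of a surjective local homeomorphism -/

section Descent

variable {V : Type*} [NormedAddCommGroup V] [NormedSpace ℝ V]
  {H : Type*} [TopologicalSpace H] (I : ModelWithCorners ℝ V H)
  {M : Type*} [TopologicalSpace M] [ChartedSpace H M]
  {N : Type*} [TopologicalSpace N]

/-- Any two points of a fibre of `f` are related by a smooth local map over the target. -/
def HasSmoothDeck (f : M → N) : Prop :=
  ∀ a b, f a = f b → ∃ s : M → M, ContMDiffAt I I ∞ s a ∧ s a = b ∧ ∀ᶠ x in 𝓝 a, f (s x) = f x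

variable {I}

theorem HasSmoothDeck.contMDiffAt_localInverse {f : M → N} (hd : HasSmoothDeck I f)
    (hf : IsLocalHomeomorph f) (c a : M) (ha : f a ∈ (hf.localInverseAt c).source) :
    ContMDiffAt I I ∞ (hf.localInverseAt c ∘ f) a := by
  obtain ⟨s, hs, hsa, hfs⟩ := hd a (hf.localInverseAt c (f a))
    (hf.apply_localInverseAt_of_mem ha).symm
  refine hs.congr_of_eventuallyEq ?_
  have h1 : ∀ᶠ x in 𝓝 a, s x ∈ (hf.localInverseAt c).target := by
    refine hs.continuousAt.eventually ((hf.localInverseAt c).open_target.mem_nhds ?_)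
    rw [hsa]
    exact (hf.localInverseAt c).map_source ha
  filter_upwards [hfs, h1] with x hx h1x
  have := (hf.localInverseAt c).right_inv h1x
  rw [hf.localInverseAt_symm] at this
  simp only [Function.comp_apply]
  rw [← hx, this]

theorem HasSmoothDeck.isManifold [IsManifold I ∞ M] {f : M → N} (hd : HasSmoothDeck I f)
    (hf : IsLocalHomeomorph f) (hs : Function.Surjective f) :
    letI := hf.chartedSpace (H := H) hs
    IsManifold I ∞ N := by
  let _ := hf.chartedSpace (H := H) hs
  apply isManifold_of_contDiffOn
  rintro e e' ⟨q, rfl⟩ ⟨q', rfl⟩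
  set g := hs.hasRightInverse.choose
  rw [← contMDiffOn_iff_contDiffOn]
  rintro v ⟨hv, u, rfl⟩
  have hu : u ∈ (((hf.localInverseAt (g q)).trans (chartAt H (g q))).symm.trans
      ((hf.localInverseAt (g q')).trans (chartAt H (g q')))).source := by
    simpa using hv
  set c := chartAt H (g q)
  set c' := chartAt H (g q')
  simp only [OpenPartialHomeomorph.trans_source, OpenPartialHomeomorph.symm_source,
    OpenPartialHomeomorph.trans_target, mem_inter_iff, mem_preimage,
    OpenPartialHomeomorph.coe_trans_symm, Function.comp_apply, hf.localInverseAt_symm] at hu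
  obtain ⟨⟨hu1, hu2⟩, hu3, hu4⟩ := hu
  have h1 : ContMDiffAt I I ∞ (c' ∘ (hf.localInverseAt (g q') ∘ f) ∘ c.symm) u := by
    refine ContMDiffAt.comp (I' := I) (M' := M) u ?_ (ContMDiffAt.comp (I' := I) (M' := M) u ?_ ?_)
    · exact (contMDiffOn_chart (I := I) (n := ∞)).contMDiffAt (c'.open_source.mem_nhds hu4)
    · exact hd.contMDiffAt_localInverse hf _ _ hu3
    · exact (contMDiffOn_chart_symm (I := I) (n := ∞)).contMDiffAt (c.open_target.mem_nhds hu1)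
  have h2 : ContMDiffWithinAt 𝓘(ℝ, V) I ∞ I.symm (range I) (I u) :=
    I.contMDiffOn_symm _ (mem_range_self u)
  have h3 : ContMDiffAt I 𝓘(ℝ, V) ∞ I (((c' ∘ (hf.localInverseAt (g q') ∘ f) ∘ c.symm)) u) :=
    I.contMDiff _
  have h4 := (h3.comp u h1)
  rw [← I.left_inv u] at h4
  have h5 := ContMDiffAt.comp_contMDiffWithinAt (I u) h4 h2
  refine (h5.mono inter_subset_right).congr_of_eventuallyEq ?_ ?_
  · refine Eventually.of_forall fun w => ?_
    simp only [Function.comp_apply, OpenPartialHomeomorph.coe_trans,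
      OpenPartialHomeomorph.coe_trans_symm, hf.localInverseAt_symm]
  · simp only [Function.comp_apply, OpenPartialHomeomorph.coe_trans,
      OpenPartialHomeomorph.coe_trans_symm, hf.localInverseAt_symm]

/-- A map out of the quotient is smooth as soon as it is smooth upstairs. -/
theorem HasSmoothDeck.contMDiff_of_comp [IsManifold I ∞ M] {f : M → N} (hd : HasSmoothDeck I f)
    (hf : IsLocalHomeomorph f) (hs : Function.Surjective f)
    {V' : Type*} [NormedAddCommGroup V'] [NormedSpace ℝ V']
    {H' : Type*} [TopologicalSpace H'] {I' : ModelWithCorners ℝ V' H'}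
    {N' : Type*} [TopologicalSpace N'] [ChartedSpace H' N'] {h : N → N'} :
    letI := hf.chartedSpace (H := H) hs
    ContMDiff I I' ∞ (h ∘ f) → ContMDiff I I' ∞ h := by
  let _ := hf.chartedSpace (H := H) hs
  intro hh q
  have := hd.isManifold hf hs
  set g := hs.hasRightInverse.choose
  have hg : Function.RightInverse g f := hs.hasRightInverse.choose_spec
  have h1 : ContMDiffAt I I ∞ (chartAt H (g q)).symm (chartAt H q q) := by
    refine (contMDiffOn_chart_symm (I := I) (n := ∞)).contMDiffAt
      ((chartAt H (g q)).open_target.mem_nhds ?_)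
    have := mem_chart_target H q
    exact this.1
  have h2 : ContMDiffAt I I ∞ (chartAt H q) q :=
    (contMDiffOn_chart (I := I) (n := ∞)).contMDiffAt ((chartAt H q).open_source.mem_nhds
      (mem_chart_source H q))
  have h3 := (hh _).comp q (h1.comp q h2)
  refine h3.congr_of_eventuallyEq ?_
  filter_upwards [(chartAt H q).open_source.mem_nhds (mem_chart_source H q)] with y hy
  have := (chartAt H q).left_inv hy
  change (hf.localInverseAt (g q)).symm _ = y at this
  rw [hf.localInverseAt_symm] at this
  simp only [Function.comp_apply]
  exact congrArg h this.symm

theorem HasSmoothDeck.contMDiff [IsManifold I ∞ M] {f : M → N} (hd : HasSmoothDeck I f)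
    (hf : IsLocalHomeomorph f) (hs : Function.Surjective f) :
    letI := hf.chartedSpace (H := H) hs
    ContMDiff I I ∞ f := by
  let _ := hf.chartedSpace (H := H) hs
  intro a
  have := hd.isManifold hf hs
  set q := f a
  set g := hs.hasRightInverse.choose
  have hg : Function.RightInverse g f := hs.hasRightInverse.choose_spec
  have hq := mem_chart_source H q
  have h1 : ContMDiffAt I I ∞ (chartAt H (g q)) ((hf.localInverseAt (g q)) (f a)) :=
    (contMDiffOn_chart (I := I) (n := ∞)).contMDiffAt
      ((chartAt H (g q)).open_source.mem_nhds hq.2)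
  have h2 := hd.contMDiffAt_localInverse hf (g q) a hq.1
  have h3 : ContMDiffAt I I ∞ (chartAt H q).symm (chartAt H q q) :=
    (contMDiffOn_chart_symm (I := I) (n := ∞)).contMDiffAt
      ((chartAt H q).open_target.mem_nhds (mem_chart_target H q))
  have h4 := ContMDiffAt.comp a h3 (h1.comp a h2)
  refine h4.congr_of_eventuallyEq ?_
  have hc : ContinuousAt f a := hf.continuous.continuousAt
  filter_upwards [hc ((chartAt H q).open_source.mem_nhds hq)] with y hy
  exact ((chartAt H q).left_inv hy).symm

end Descent

/-! Crystallographic groups, the translation torus and the affine action of the point group -/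

/-- The Euclidean group `E(d)`, of all maps `x ↦ A x + a` with `A` orthogonal. -/
abbrev EuclideanGroup (d : ℕ) : Type :=
  EuclideanSpace ℝ (Fin d) ≃ᵃⁱ[ℝ] EuclideanSpace ℝ (Fin d)

namespace EuclideanGroup

variable {d : ℕ}

/-- The translation part `a` and the orthogonal part `A` of a motion `x ↦ A x + a`. -/
def parts (g : EuclideanGroup d) :
    EuclideanSpace ℝ (Fin d) × (EuclideanSpace ℝ (Fin d) →L[ℝ] EuclideanSpace ℝ (Fin d)) :=
  (g 0, (g.linearIsometryEquiv : EuclideanSpace ℝ (Fin d) →L[ℝ] EuclideanSpace ℝ (Fin d)))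

/-- The usual topology of `E(d) = ℝ^d ⋊ O(d)`. -/
instance : TopologicalSpace (EuclideanGroup d) := TopologicalSpace.induced parts inferInstance

instance : MulAction (EuclideanGroup d) (EuclideanSpace ℝ (Fin d)) where
  smul g x := g x
  one_smul _ := rfl
  mul_smul _ _ _ := rfl

/-- The translation by `v`. -/
abbrev translation (v : EuclideanSpace ℝ (Fin d)) : EuclideanGroup d :=
  AffineIsometryEquiv.constVAdd ℝ (EuclideanSpace ℝ (Fin d)) v

end EuclideanGroup

/-- A crystallographic group: a discrete subgroup of `E(d)` with compact orbit space. -/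
structure CrystallographicGroup (d : ℕ) where
  toSubgroup : Subgroup (EuclideanGroup d)
  discrete : IsDiscrete (toSubgroup : Set (EuclideanGroup d))
  cocompact : CompactSpace
    (MulAction.orbitRel.Quotient toSubgroup (EuclideanSpace ℝ (Fin d)))

namespace CrystallographicGroup

variable {d : ℕ} (Γ : CrystallographicGroup d)

/-- The translation lattice `Π = Γ ∩ ℝ^d`. -/
def lattice : AddSubgroup (EuclideanSpace ℝ (Fin d)) where
  carrier := {v | EuclideanGroup.translation v ∈ Γ.toSubgroup}
  zero_mem' := by
    have : EuclideanGroup.translation (0 : EuclideanSpace ℝ (Fin d)) = 1 := by ext; simp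
    simp only [mem_ofPred_eq, this, one_mem]
  add_mem' {v w} hv hw := by
    have : EuclideanGroup.translation (v + w)
        = EuclideanGroup.translation v * EuclideanGroup.translation w := by
      ext; simp [add_assoc]
    simp only [mem_ofPred_eq, this]
    exact mul_mem hv hw
  neg_mem' {v} hv := by
    have : EuclideanGroup.translation (-v) = (EuclideanGroup.translation v)⁻¹ := by
      rw [eq_inv_iff_mul_eq_one]; ext; simp
    simp only [mem_ofPred_eq, this]
    exact inv_mem hv

/-- `Π` as a subgroup of `Γ`: the motions in `Γ` that are pure translations. -/
def translations : Subgroup Γ.toSubgroup where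
  carrier := {γ | ∃ v, (γ : EuclideanGroup d) = EuclideanGroup.translation v}
  one_mem' := ⟨0, by ext; simp⟩
  mul_mem' := by
    rintro a b ⟨v, hv⟩ ⟨w, hw⟩
    exact ⟨v + w, by ext; simp [hv, hw, add_assoc]⟩
  inv_mem' := by
    rintro a ⟨v, hv⟩
    refine ⟨-v, ?_⟩
    rw [Subgroup.coe_inv, hv, inv_eq_iff_mul_eq_one]; ext; simp

theorem apply_add (g : EuclideanGroup d) (v x : EuclideanSpace ℝ (Fin d)) :
    g (v + x) = g.linearIsometryEquiv v + g x := g.map_vadd x v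

theorem conj_translation (g : EuclideanGroup d) (v : EuclideanSpace ℝ (Fin d)) :
    g * EuclideanGroup.translation v * g⁻¹
      = EuclideanGroup.translation (g.linearIsometryEquiv v) := by
  rw [mul_inv_eq_iff_eq_mul]
  ext x : 1
  simp only [AffineIsometryEquiv.coe_mul, Function.comp_apply,
    AffineIsometryEquiv.coe_constVAdd, vadd_eq_add, apply_add]

instance : Γ.translations.Normal where
  conj_mem := by
    rintro a ⟨v, hv⟩ g
    exact ⟨(g : EuclideanGroup d).linearIsometryEquiv v, by simp [hv, conj_translation]⟩

/-- The point group `P = Γ / Π`. -/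
def PointGroup : Type := Γ.toSubgroup ⧸ Γ.translations

instance : Group Γ.PointGroup := inferInstanceAs (Group (Γ.toSubgroup ⧸ Γ.translations))

/-- The point group is discrete. -/
instance : TopologicalSpace Γ.PointGroup := ⊥

instance : DiscreteTopology Γ.PointGroup := ⟨rfl⟩

/-- The translation torus `T_Π = ℝ^d / Π`. -/
def Torus : Type := EuclideanSpace ℝ (Fin d) ⧸ Γ.lattice

instance : TopologicalSpace Γ.Torus :=
  inferInstanceAs (TopologicalSpace (EuclideanSpace ℝ (Fin d) ⧸ Γ.lattice))

instance : Inhabited Γ.Torus := ⟨((0 : EuclideanSpace ℝ (Fin d)) : _ ⧸ Γ.lattice)⟩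

/-- The class `[v]` of `v` in `ℝ^d / Π`. -/
def torusMk (v : EuclideanSpace ℝ (Fin d)) : Γ.Torus := (v : _ ⧸ Γ.lattice)

theorem torusMk_eq {v w : EuclideanSpace ℝ (Fin d)} :
    Γ.torusMk v = Γ.torusMk w ↔ -v + w ∈ Γ.lattice := QuotientAddGroup.eq

theorem torusMk_surjective : Function.Surjective Γ.torusMk := QuotientAddGroup.mk_surjective

theorem linear_mem_lattice (γ : Γ.toSubgroup) {v : EuclideanSpace ℝ (Fin d)}
    (hv : v ∈ Γ.lattice) :
    (γ : EuclideanGroup d).linearIsometryEquiv v ∈ Γ.lattice := by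
  change EuclideanGroup.translation _ ∈ Γ.toSubgroup
  rw [← conj_translation]
  exact mul_mem (mul_mem γ.2 hv) (inv_mem γ.2)

theorem isDiscrete_lattice : IsDiscrete (Γ.lattice : Set (EuclideanSpace ℝ (Fin d))) := by
  have := Γ.discrete.to_subtype
  have hc : Continuous (fun v : EuclideanSpace ℝ (Fin d) => EuclideanGroup.translation v) := by
    refine continuous_induced_rng.2 ?_
    have : EuclideanGroup.parts ∘ (fun v : EuclideanSpace ℝ (Fin d) =>
        EuclideanGroup.translation v) = fun v => (v, ContinuousLinearMap.id ℝ _) := by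
      funext v
      refine Prod.ext (by simp [EuclideanGroup.parts]) ?_
      ext1 x
      have := apply_add (EuclideanGroup.translation v) x 0
      simp only [AffineIsometryEquiv.coe_constVAdd, vadd_eq_add, add_zero] at this
      have h2 : (EuclideanGroup.translation v).linearIsometryEquiv x = x := by
        rw [add_comm] at this; exact (add_right_cancel this).symm
      simpa [EuclideanGroup.parts] using h2
    rw [this]
    fun_prop
  let φ : Γ.lattice → Γ.toSubgroup := fun v => ⟨EuclideanGroup.translation v.1, v.2⟩
  have hφ : Continuous φ := (hc.comp continuous_subtype_val).subtype_mk _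
  have hi : Function.Injective φ := by
    intro v w h
    have := congrArg (fun g : Γ.toSubgroup => (g : EuclideanGroup d) 0) h
    ext1
    simpa [φ] using this
  exact ⟨DiscreteTopology.of_continuous_injective hφ hi⟩

theorem isLocalHomeomorph_torusMk : IsLocalHomeomorph Γ.torusMk :=
  (Γ.lattice.isAddQuotientCoveringMap_of_comm Γ.isDiscrete_lattice).isCoveringMap.isLocalHomeomorph

theorem hasSmoothDeck_torusMk : HasSmoothDeck 𝓘(ℝ, EuclideanSpace ℝ (Fin d)) Γ.torusMk := by
  intro a b hab
  refine ⟨fun x => x + (-a + b), ?_, by simp, Eventually.of_forall fun x => ?_⟩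
  · exact (contDiff_id.add contDiff_const).contMDiff.contMDiffAt
  · rw [torusMk_eq] at hab ⊢
    have : -(x + (-a + b)) + x = -(-a + b) := by abel
    rw [this]
    exact neg_mem hab

/-- The smooth structure of `ℝ^d / Π`, carried down from `ℝ^d` by the covering `v ↦ [v]`. -/
instance : ChartedSpace (EuclideanSpace ℝ (Fin d)) Γ.Torus :=
  Γ.isLocalHomeomorph_torusMk.chartedSpace Γ.torusMk_surjective

instance : IsManifold 𝓘(ℝ, EuclideanSpace ℝ (Fin d)) ∞ Γ.Torus :=
  Γ.hasSmoothDeck_torusMk.isManifold _ _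

/-- The action of `Γ` on `ℝ^d / Π`: the motion `γ` sends `[v]` to `[γ v]`. -/
def torusPerm : Γ.toSubgroup →* Function.End Γ.Torus where
  toFun γ := Quotient.map' (fun v => (γ : EuclideanGroup d) v) (by
    intro v w h
    rw [QuotientAddGroup.leftRel_apply] at h ⊢
    have := Γ.linear_mem_lattice γ h
    have h2 := (γ : EuclideanGroup d).map_vsub w v
    simp only [vsub_eq_sub] at h2
    rwa [neg_add_eq_sub, h2, ← neg_add_eq_sub] at this)
  map_one' := by
    funext τ; obtain ⟨v, rfl⟩ := Γ.torusMk_surjective τ; rfl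
  map_mul' γ γ' := by
    funext τ; obtain ⟨v, rfl⟩ := Γ.torusMk_surjective τ; rfl

theorem torusPerm_mk (γ : Γ.toSubgroup) (v : EuclideanSpace ℝ (Fin d)) :
    Γ.torusPerm γ (Γ.torusMk v) = Γ.torusMk ((γ : EuclideanGroup d) v) := rfl

/-- The affine action `ρ(p)[v] = [A_p v + a_p]` of the point group on the translation torus, where
`x ↦ A_p x + a_p` is any representative of `p` in `Γ`. -/
def rho : Γ.PointGroup →* Function.End Γ.Torus :=
  QuotientGroup.lift Γ.translations Γ.torusPerm (by
    rintro γ ⟨v, hv⟩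
    rw [MonoidHom.mem_ker]
    funext τ
    obtain ⟨w, rfl⟩ := Γ.torusMk_surjective τ
    rw [torusPerm_mk]
    refine Γ.torusMk_eq.2 ?_
    have hvm : v ∈ Γ.lattice := by
      change EuclideanGroup.translation v ∈ Γ.toSubgroup
      rw [← hv]; exact γ.2
    have : -((γ : EuclideanGroup d) w) + w = -v := by
      rw [hv]; simp
    rw [this]
    exact neg_mem hvm)

theorem rho_mk (γ : Γ.toSubgroup) (v : EuclideanSpace ℝ (Fin d)) :
    Γ.rho (QuotientGroup.mk γ : Γ.toSubgroup ⧸ Γ.translations) (Γ.torusMk v)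
      = Γ.torusMk ((γ : EuclideanGroup d).linearIsometryEquiv v + (γ : EuclideanGroup d) 0) := by
  rw [← apply_add, add_zero]; rfl

theorem contMDiff_rho (p : Γ.PointGroup) :
    ContMDiff 𝓘(ℝ, EuclideanSpace ℝ (Fin d)) 𝓘(ℝ, EuclideanSpace ℝ (Fin d)) ∞ (Γ.rho p) := by
  obtain ⟨γ, rfl⟩ := QuotientGroup.mk_surjective (s := Γ.translations) p
  refine Γ.hasSmoothDeck_torusMk.contMDiff_of_comp Γ.isLocalHomeomorph_torusMk
    Γ.torusMk_surjective ?_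
  have h1 : ContMDiff 𝓘(ℝ, EuclideanSpace ℝ (Fin d)) 𝓘(ℝ, EuclideanSpace ℝ (Fin d)) ∞
      (fun v : EuclideanSpace ℝ (Fin d) =>
        (γ : EuclideanGroup d).linearIsometryEquiv v + (γ : EuclideanGroup d) 0) :=
    (((γ : EuclideanGroup d).linearIsometryEquiv.toContinuousLinearEquiv.contDiff).add
      contDiff_const).contMDiff
  have h2 := (Γ.hasSmoothDeck_torusMk.contMDiff Γ.isLocalHomeomorph_torusMk
    Γ.torusMk_surjective).comp h1
  refine h2.congr fun v => ?_
  exact Γ.rho_mk γ v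

end CrystallographicGroup

/-! Principal bundles with the point group as structure group -/

section Bundle

open MulOpposite

variable {d : ℕ} (Γ : CrystallographicGroup d)
  (E : Type*) [NormedAddCommGroup E] [NormedSpace ℝ E]
  {X : Type*} [TopologicalSpace X] [ChartedSpace E X]
  {Q : Type*} [TopologicalSpace Q] [ChartedSpace E Q] [MulAction Γ.PointGroupᵐᵒᵖ Q]

/-- `π : Q → X` is a smooth principal bundle for the discrete point group `P`, which acts on `Q`
from the right: around each point of `X` there is an equivariant diffeomorphism
`π⁻¹(U) ≃ U × P` over `U`. -/
structure IsPrincipalBundle (π : Q → X) : Prop where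
  contMDiff_proj : ContMDiff 𝓘(ℝ, E) 𝓘(ℝ, E) ∞ π
  contMDiff_smul : ∀ p : Γ.PointGroup, ContMDiff 𝓘(ℝ, E) 𝓘(ℝ, E) ∞ (fun q : Q => op p • q)
  proj_smul : ∀ (p : Γ.PointGroup) (q : Q), π (op p • q) = π q
  locally_trivial : ∀ x : X, ∃ e : Bundle.Trivialization Γ.PointGroup π, x ∈ e.baseSet ∧
    (∀ q : Q, π q ∈ e.baseSet → ∀ p : Γ.PointGroup, (e (op p • q)).2 = (e q).2 * p) ∧
    ∀ p : Γ.PointGroup,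
      ContMDiffOn 𝓘(ℝ, E) 𝓘(ℝ, E) ∞ (fun x => e.toOpenPartialHomeomorph.symm (x, p)) e.baseSet

/-- A smooth section of `π : Q → X` over an open set. -/
structure SmoothLocalSection (E : Type*) [NormedAddCommGroup E] [NormedSpace ℝ E]
    {X : Type*} [TopologicalSpace X] [ChartedSpace E X]
    {Q : Type*} [TopologicalSpace Q] [ChartedSpace E Q] (π : Q → X) where
  dom : Set X
  isOpen_dom : IsOpen dom
  toFun : X → Q
  contMDiffOn : ContMDiffOn 𝓘(ℝ, E) 𝓘(ℝ, E) ∞ toFun dom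
  proj_toFun : ∀ x ∈ dom, π (toFun x) = x

/-- The relation `(q, τ) ∼ (q p, ρ(p⁻¹) τ)` on `Q × T_Π`. -/
def assocSetoid (Q : Type*) [MulAction Γ.PointGroupᵐᵒᵖ Q] : Setoid (Q × Γ.Torus) where
  r a b := ∃ p : Γ.PointGroup, b = (op p • a.1, Γ.rho p⁻¹ a.2)
  iseqv :=
    { refl := fun a => ⟨1, by simp; rfl⟩
      symm := by
        rintro a _ ⟨p, rfl⟩
        refine ⟨p⁻¹, ?_⟩
        refine Prod.ext ?_ ?_
        · simp [smul_smul]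
        · change a.2 = (Γ.rho p⁻¹⁻¹ * Γ.rho p⁻¹) a.2
          rw [← map_mul]; simp; rfl
      trans := by
        rintro a _ _ ⟨p, rfl⟩ ⟨p', rfl⟩
        refine ⟨p * p', ?_⟩
        refine Prod.ext ?_ ?_
        · simp [smul_smul, ← op_mul]
        · change (Γ.rho p'⁻¹ * Γ.rho p⁻¹) a.2 = _
          rw [← map_mul]; simp }

variable {Γ E} {π : Q → X}

namespace IsPrincipalBundle

theorem eq_one_of_smul_eq (hQ : IsPrincipalBundle Γ E π) {p : Γ.PointGroup} {q : Q}
    (h : op p • q = q) : p = 1 := by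
  obtain ⟨e, hx, he, -⟩ := hQ.locally_trivial (π q)
  have := he q hx p
  rw [h] at this
  exact left_eq_mul.1 this

theorem exists_smul_eq (hQ : IsPrincipalBundle Γ E π) {q q' : Q} (h : π q = π q') :
    ∃ p : Γ.PointGroup, op p • q = q' := by
  obtain ⟨e, hx, he, -⟩ := hQ.locally_trivial (π q)
  have hx' : π q' ∈ e.baseSet := h ▸ hx
  refine ⟨(e q).2⁻¹ * (e q').2, ?_⟩
  have hm : op ((e q).2⁻¹ * (e q').2) • q ∈ e.source := by
    rw [e.mem_source, hQ.proj_smul]; exact hx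
  refine e.injOn hm (e.mem_source.2 hx') ?_
  refine Prod.ext ?_ ?_
  · change (e _).1 = (e _).1
    rw [e.coe_fst hm, e.coe_fst (e.mem_source.2 hx'), hQ.proj_smul, h]
  · change (e _).2 = (e _).2
    rw [he q hx]; simp

/-- The associated bundle `Y_Π = Q ×_P T_Π = (Q × T_Π) / P`. -/
def Assoc (_hQ : IsPrincipalBundle Γ E π) : Type _ := Quotient (assocSetoid Γ Q)

variable (hQ : IsPrincipalBundle Γ E π)

/-- The class `[q, τ]` in `Q ×_P T_Π`. -/
def cls (a : Q × Γ.Torus) : hQ.Assoc := Quotient.mk (assocSetoid Γ Q) a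

theorem cls_surjective : Function.Surjective hQ.cls := Quotient.mk_surjective

theorem cls_eq {a b : Q × Γ.Torus} :
    hQ.cls a = hQ.cls b ↔ ∃ p : Γ.PointGroup, b = (op p • a.1, Γ.rho p⁻¹ a.2) :=
  Quotient.eq (r := assocSetoid Γ Q)

/-- The quotient topology on `(Q × T_Π) / P`. -/
instance : TopologicalSpace hQ.Assoc :=
  inferInstanceAs (TopologicalSpace (Quotient (assocSetoid Γ Q)))

/-- The projection `π_Y : Y_Π → X`, `[q, τ] ↦ π q`. -/
def proj : hQ.Assoc → X :=
  Quotient.lift (fun a : Q × Γ.Torus => π a.1) (by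
    rintro a _ ⟨p, rfl⟩
    exact (hQ.proj_smul p a.1).symm)

/-- The right action `(q, τ) p = (q p, ρ(p⁻¹) τ)` of an element of the point group. -/
def act (_hQ : IsPrincipalBundle Γ E π) (p : Γ.PointGroup) (a : Q × Γ.Torus) : Q × Γ.Torus :=
  (op p • a.1, Γ.rho p⁻¹ a.2)

theorem cls_act (p : Γ.PointGroup) (a : Q × Γ.Torus) : hQ.cls (hQ.act p a) = hQ.cls a :=
  (hQ.cls_eq.2 ⟨p, rfl⟩).symm

theorem contMDiff_act (p : Γ.PointGroup) :
    ContMDiff (𝓘(ℝ, E).prod 𝓘(ℝ, EuclideanSpace ℝ (Fin d)))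
      (𝓘(ℝ, E).prod 𝓘(ℝ, EuclideanSpace ℝ (Fin d))) ∞ (hQ.act p) :=
  ((hQ.contMDiff_smul p).comp contMDiff_fst).prodMk ((Γ.contMDiff_rho _).comp contMDiff_snd)

theorem hasSmoothDeck_cls :
    HasSmoothDeck (𝓘(ℝ, E).prod 𝓘(ℝ, EuclideanSpace ℝ (Fin d))) hQ.cls := by
  intro a b hab
  obtain ⟨p, rfl⟩ := hQ.cls_eq.1 hab
  exact ⟨hQ.act p, (hQ.contMDiff_act p).contMDiffAt, rfl,
    Eventually.of_forall fun x => hQ.cls_act p x⟩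

theorem isQuotientMap_cls : IsQuotientMap hQ.cls := isQuotientMap_quotient_mk'

theorem isOpenMap_cls : IsOpenMap hQ.cls := by
  intro U hU
  rw [← hQ.isQuotientMap_cls.isOpen_preimage]
  have : hQ.cls ⁻¹' (hQ.cls '' U) = ⋃ p, hQ.act p ⁻¹' U := by
    ext b
    simp only [mem_preimage, mem_iUnion]
    constructor
    · rintro ⟨a, ha, h⟩
      obtain ⟨p, hp⟩ := hQ.cls_eq.1 h.symm
      exact ⟨p, by rw [act, ← hp]; exact ha⟩
    · rintro ⟨p, hp⟩
      exact ⟨_, hp, hQ.cls_act p b⟩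
  rw [this]
  exact isOpen_iUnion fun p => hU.preimage (hQ.contMDiff_act p).continuous

theorem isLocalHomeomorph_cls : IsLocalHomeomorph hQ.cls := by
  rw [isLocalHomeomorph_iff_isOpenEmbedding_restrict]
  rintro a
  obtain ⟨e, hx, he, -⟩ := hQ.locally_trivial (π a.1)
  set W : Set (Q × Γ.Torus) := {b | b.1 ∈ e.source ∧ (e b.1).2 = (e a.1).2}
  have hW : IsOpen W := by
    have h1 : IsOpen (e.source ∩ e ⁻¹' (univ ×ˢ {(e a.1).2})) :=
      e.toOpenPartialHomeomorph.isOpen_inter_preimage (isOpen_univ.prod (isOpen_discrete _))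
    have h2 := h1.preimage (continuous_fst (X := Q) (Y := Γ.Torus))
    convert h2 using 1
    ext b
    simp [W]
  refine ⟨W, hW.mem_nhds ⟨e.mem_source.2 hx, rfl⟩, ?_⟩
  refine IsOpenEmbedding.of_continuous_injective_isOpenMap
    (hQ.isQuotientMap_cls.continuous.comp continuous_subtype_val) ?_ (hQ.isOpenMap_cls.comp hW.isOpenMap_subtype_val)
  rintro ⟨b, hb⟩ ⟨c, hc⟩ h
  obtain ⟨p, rfl⟩ := hQ.cls_eq.1 h
  have hb2 := hb.2
  have hc2 := hc.2
  simp only [he b.1 (e.mem_source.1 hb.1)] at hc2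
  rw [hb2] at hc2
  have hp : p = 1 := mul_eq_left.1 hc2
  subst hp
  refine Subtype.ext (Prod.ext ?_ ?_)
  · simp
  · simp only [inv_one, map_one]; rfl

/-- The smooth structure of `Y_Π`, carried down from `Q × T_Π` by the covering
`(q, τ) ↦ [q, τ]`. -/
instance : ChartedSpace (ModelProd E (EuclideanSpace ℝ (Fin d))) hQ.Assoc :=
  hQ.isLocalHomeomorph_cls.chartedSpace hQ.cls_surjective

instance [IsManifold 𝓘(ℝ, E) ∞ Q] :
    IsManifold (𝓘(ℝ, E).prod 𝓘(ℝ, EuclideanSpace ℝ (Fin d))) ∞ hQ.Assoc :=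
  hQ.hasSmoothDeck_cls.isManifold _ _

theorem exists_fiberCoord (z : SmoothLocalSection E π) (y : hQ.Assoc) (hy : hQ.proj y ∈ z.dom) :
    ∃ τ, hQ.cls (z.toFun (hQ.proj y), τ) = y := by
  obtain ⟨a, rfl⟩ := hQ.cls_surjective y
  obtain ⟨p, hp⟩ := hQ.exists_smul_eq (q := a.1) (q' := z.toFun (hQ.proj (hQ.cls a)))
    (z.proj_toFun _ hy).symm
  exact ⟨Γ.rho p⁻¹ a.2, (hQ.cls_eq.2 ⟨p, by rw [hp]⟩).symm⟩

open Classical in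
/-- The local trivialization `ψ : π_Y⁻¹(U) → U × T_Π` of `Y_Π` given by a section `z : U → Q`; it
is determined by `ψ [z x, τ] = (x, τ)`. -/
def localTriv (z : SmoothLocalSection E π) (y : hQ.Assoc) : X × Γ.Torus :=
  (hQ.proj y, if h : ∃ τ, hQ.cls (z.toFun (hQ.proj y), τ) = y then h.choose else default)

theorem localTriv_cls (z : SmoothLocalSection E π) {x : X} (hx : x ∈ z.dom) (τ : Γ.Torus) :
    hQ.localTriv z (hQ.cls (z.toFun x, τ)) = (x, τ) := by
  have hp : hQ.proj (hQ.cls (z.toFun x, τ)) = x := z.proj_toFun x hx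
  have h : ∃ τ', hQ.cls (z.toFun (hQ.proj (hQ.cls (z.toFun x, τ))), τ') = hQ.cls (z.toFun x, τ) :=
    ⟨τ, by rw [hp]⟩
  refine Prod.ext hp ?_
  simp only [localTriv, dif_pos h]
  have hs := h.choose_spec
  generalize h.choose = σ at hs
  rw [hp] at hs
  obtain ⟨p, hpe⟩ := hQ.cls_eq.1 hs
  have h1 := hQ.eq_one_of_smul_eq (congrArg Prod.fst hpe).symm
  subst h1
  have h2 := congrArg Prod.snd hpe
  simp only [inv_one, map_one] at h2
  exact h2.symm

end IsPrincipalBundle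

end Bundle

/-! Distributions and Ehresmann connections -/

section Distributions

variable {V : Type*} [NormedAddCommGroup V] [NormedSpace ℝ V]
  {H : Type*} [TopologicalSpace H] (I : ModelWithCorners ℝ V H)
  {N : Type*} [TopologicalSpace N] [ChartedSpace H N]

/-- A choice of a linear subspace of each tangent space of `N`. -/
abbrev TangentSubspaces (N : Type*) [TopologicalSpace N] [ChartedSpace H N] :=
  (y : N) → Submodule ℝ (TangentSpace I y)

variable {I}

/-- `D` is a smooth subbundle of rank `k` of `TN`: it has smooth local frames. -/
def IsSmoothSubbundle [IsManifold I 1 N] (k : ℕ) (D : TangentSubspaces I N) : Prop :=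
  ∀ y : N, ∃ U : Set N, IsOpen U ∧ y ∈ U ∧ ∃ S : Fin k → (y : N) → TangentSpace I y,
    (∀ i, ContMDiffOn I I.tangent ∞ (fun y => (⟨y, S i y⟩ : TangentBundle I N)) U) ∧
    ∀ y ∈ U, LinearIndependent ℝ (fun i => S i y) ∧
      Submodule.span ℝ (range fun i => S i y) = D y

/-- `D` is involutive: the Lie bracket of two smooth vector fields with values in `D`, defined on an
open set, has values in `D`. -/
def IsInvolutive [IsManifold I 1 N] (D : TangentSubspaces I N) : Prop :=
  ∀ (U : Set N), IsOpen U → ∀ S S' : (y : N) → TangentSpace I y,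
    ContMDiffOn I I.tangent ∞ (fun y => (⟨y, S y⟩ : TangentBundle I N)) U →
    ContMDiffOn I I.tangent ∞ (fun y => (⟨y, S' y⟩ : TangentBundle I N)) U →
    (∀ y ∈ U, S y ∈ D y) → (∀ y ∈ U, S' y ∈ D y) →
    ∀ y ∈ U, VectorField.mlieBracket I S S' y ∈ D y

/-- `D` is integrable: around each point there is a chart of the smooth structure in which `D` is a
constant linear subspace of the model space, so that the slices parallel to that subspace are
integral manifolds. -/
def IsIntegrableDistribution (D : TangentSubspaces I N) : Prop :=
  ∀ y : N, ∃ φ ∈ IsManifold.maximalAtlas I ∞ N, y ∈ φ.source ∧ ∃ K : Submodule ℝ V,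
    ∀ y' ∈ φ.source, ∀ v : TangentSpace I y', v ∈ D y' ↔ (mfderiv I I φ y' v : V) ∈ K

/-- The vertical spaces `ker T_yπ` of a map `π`. -/
def verticalSpaces {V' : Type*} [NormedAddCommGroup V'] [NormedSpace ℝ V']
    {H' : Type*} [TopologicalSpace H'] (I' : ModelWithCorners ℝ V' H')
    {X : Type*} [TopologicalSpace X] [ChartedSpace H' X] (π : N → X) : TangentSubspaces I N :=
  fun y => LinearMap.ker (mfderiv I I' π y : TangentSpace I y →ₗ[ℝ] TangentSpace I' (π y))

/-- `D` is an Ehresmann connection on `π : N → X`: a smooth subbundle of `TN`, of rank `k = dim X`,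
which is complementary to the vertical spaces, `TN = D ⊕ ker Tπ`. -/
structure IsEhresmannConnection [IsManifold I 1 N]
    {V' : Type*} [NormedAddCommGroup V'] [NormedSpace ℝ V']
    {H' : Type*} [TopologicalSpace H'] (I' : ModelWithCorners ℝ V' H')
    {X : Type*} [TopologicalSpace X] [ChartedSpace H' X] (π : N → X)
    (D : TangentSubspaces I N) : Prop where
  isSmoothSubbundle : IsSmoothSubbundle (Module.finrank ℝ V') D
  isCompl : ∀ y, IsCompl (D y) (verticalSpaces I' π y)

end Distributions

namespace IsPrincipalBundle

variable {d : ℕ} {Γ : CrystallographicGroup d}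
  {E : Type*} [NormedAddCommGroup E] [NormedSpace ℝ E]
  {X : Type*} [TopologicalSpace X] [ChartedSpace E X]
  {Q : Type*} [TopologicalSpace Q] [ChartedSpace E Q] [MulAction Γ.PointGroupᵐᵒᵖ Q]
  {π : Q → X} (hQ : IsPrincipalBundle Γ E π)

/-- The subspace `T_xX ⊕ 0` of `T_(x,τ)(X × T_Π) = T_xX ⊕ T_τT_Π`. -/
def productHorizontal (E : Type*) [NormedAddCommGroup E] [NormedSpace ℝ E]
    (X : Type*) [TopologicalSpace X] [ChartedSpace E X] (Γ : CrystallographicGroup d) :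
    TangentSubspaces (𝓘(ℝ, E).prod 𝓘(ℝ, EuclideanSpace ℝ (Fin d))) (X × Γ.Torus) :=
  fun _ => ((⊤ : Submodule ℝ E).prod (⊥ : Submodule ℝ (EuclideanSpace ℝ (Fin d))) :)

/-- The local horizontal spaces on `π_Y⁻¹(U)`: the subspaces `TU ⊕ 0` of `T(U × T_Π)`, transported
to `Y_Π` by the trivialization given by a section `z : U → Q`. -/
def localHorizontal (z : SmoothLocalSection E π) :
    TangentSubspaces (𝓘(ℝ, E).prod 𝓘(ℝ, EuclideanSpace ℝ (Fin d))) hQ.Assoc :=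
  fun y => (productHorizontal E X Γ (hQ.localTriv z y)).comap
    (mfderiv (𝓘(ℝ, E).prod 𝓘(ℝ, EuclideanSpace ℝ (Fin d)))
      (𝓘(ℝ, E).prod 𝓘(ℝ, EuclideanSpace ℝ (Fin d))) (hQ.localTriv z) y :
      TangentSpace _ y →ₗ[ℝ] TangentSpace _ (hQ.localTriv z y))

/-- On the part of `Y_Π` over the domains of the sections in `S`, the subspaces `D` are the local
horizontal spaces. -/
def IsGluing (S : Set (SmoothLocalSection E π))
    (D : TangentSubspaces (𝓘(ℝ, E).prod 𝓘(ℝ, EuclideanSpace ℝ (Fin d))) hQ.Assoc) : Prop :=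
  ∀ z ∈ S, ∀ y, hQ.proj y ∈ z.dom → D y = hQ.localHorizontal z y

end IsPrincipalBundle

end

/-! The structure group `P` is discrete, so a local section of `Q` is determined near a point by its
value there, and two local sections `z`, `z'` satisfy `z' = z p` near each common point for one
fixed `p`. Hence the torus coordinates of the trivializations of `Y_Π` given by `z` and `z'` differ
by the fixed diffeomorphism `ρ(p⁻¹)` there (`IsPrincipalBundle.localTriv_snd_eventuallyEq`). As
the local horizontal space is the kernel of the derivative of the torus coordinate
(`mem_localHorizontal_iff`), it does not depend on the section (`localHorizontal_eq`), and the local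
horizontal spaces glue to one family `IsPrincipalBundle.horizontal`.

A trivialization is a diffeomorphism from an open part of `Y_Π` onto an open part of `X × T_Π`.
Composed with a product chart it is a chart of `Y_Π` (`trivChart_mem_maximalAtlas`) in which the
horizontal spaces are the constant subspace `E × 0` of `E × ℝ^d`. So they are integrable, and the
remaining properties hold for every distribution that is constant in suitable charts: pulled back
constant vector fields are local frames (`isSmoothSubbundle_of_isStraightenedBy`), and brackets of
vector fields with values in a constant subspace stay in it
(`IsIntegrableDistribution.isInvolutive`). The complement property is that of `E × 0` and the kernel
of the first projection, which is carried over by the derivative of the trivialization. -/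

/-! ### Charts of the smooth structure, and distributions that are constant in charts -/

section Charts

variable {V : Type*} [NormedAddCommGroup V] [NormedSpace ℝ V]
  {H : Type*} [TopologicalSpace H] {I : ModelWithCorners ℝ V H}
  {N : Type*} [TopologicalSpace N] [ChartedSpace H N]

theorem mem_contDiffGroupoid_of_contMDiffOn {e : OpenPartialHomeomorph H H}
    (h : ContMDiffOn I I ∞ e e.source) (h' : ContMDiffOn I I ∞ e.symm e.target) :
    e ∈ contDiffGroupoid ∞ I := by
  have key : ∀ {f : H → H} {s : Set H}, ContMDiffOn I I ∞ f s →
      ContDiffOn ℝ ∞ (I ∘ f ∘ I.symm) (I.symm ⁻¹' s ∩ range I) := by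
    intro f s hf
    rw [← contMDiffOn_iff_contDiffOn]
    exact I.contMDiff.comp_contMDiffOn
      (hf.comp (I.contMDiffOn_symm.mono inter_subset_right) fun x hx => hx.1)
  exact mem_groupoid_of_pregroupoid.2 ⟨key h, key h'⟩

theorem mem_maximalAtlas_of_contMDiffOn [IsManifold I ∞ N] {φ : OpenPartialHomeomorph N H}
    (h : ContMDiffOn I I ∞ φ φ.source) (h' : ContMDiffOn I I ∞ φ.symm φ.target) :
    φ ∈ IsManifold.maximalAtlas I ∞ N := by
  have key : ∀ e ∈ atlas H N, φ.symm.trans e ∈ contDiffGroupoid ∞ I := by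
    intro e he
    have he' := IsManifold.subset_maximalAtlas (I := I) (n := ∞) he
    refine mem_contDiffGroupoid_of_contMDiffOn ?_ ?_
    · refine (contMDiffOn_of_mem_maximalAtlas he').comp (h'.mono fun x hx => ?_) fun x hx => ?_
      · simpa using hx.1
      · simpa using hx.2
    · refine h.comp ((contMDiffOn_symm_of_mem_maximalAtlas he').mono fun x hx => ?_) fun x hx => ?_
      · simpa using hx.1
      · simpa using hx.2
  refine mem_maximalAtlas_iff.2 fun e he => ⟨key e he, ?_⟩
  have := (contDiffGroupoid ∞ I).symm (key e he)
  rwa [OpenPartialHomeomorph.trans_symm_eq_symm_trans_symm] at this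

/-- The bracket of two vector fields on a vector space with values in a fixed closed subspace has
values in that subspace, since the difference quotients of the fields do. Differentiability is not
needed: `fderiv` is zero at points where it fails. -/
theorem mlieBracket_mem {K : Submodule ℝ V} (hK : IsClosed (K : Set V))
    {W W' : (x : V) → TangentSpace 𝓘(ℝ, V) x} {x : V}
    (hW : ∀ᶠ z in 𝓝 x, (W z : V) ∈ K) (hW' : ∀ᶠ z in 𝓝 x, (W' z : V) ∈ K) :
    (VectorField.mlieBracket 𝓘(ℝ, V) W W' x : V) ∈ K := by
  have key : ∀ {F : V → V}, (∀ᶠ z in 𝓝 x, F z ∈ K) → ∀ v, fderiv ℝ F x v ∈ K := by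
    intro F hF v
    by_cases hd : DifferentiableAt ℝ F x
    · have := (hd.hasFDerivAt.hasLineDerivAt v).tendsto_slope_zero
      refine hK.mem_of_tendsto this ?_
      have h2 : Tendsto (fun t : ℝ => x + t • v) (𝓝[≠] 0) (𝓝 x) := by
        have : Continuous (fun t : ℝ => x + t • v) := by fun_prop
        have h3 := this.tendsto 0
        simp only [zero_smul, add_zero] at h3
        exact h3.mono_left nhdsWithin_le_nhds
      filter_upwards [h2.eventually hF] with t ht
      exact K.smul_mem _ (K.sub_mem ht hF.self_of_nhds)
    · rw [fderiv_zero_of_not_differentiableAt hd]; exact K.zero_mem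
  have h : (VectorField.mlieBracket 𝓘(ℝ, V) W W' : V → V) = VectorField.lieBracket ℝ W W' :=
    (VectorField.mlieBracketWithin_univ (I := 𝓘(ℝ, V))).symm.trans
      (VectorField.mlieBracketWithin_eq_lieBracketWithin.trans VectorField.lieBracketWithin_univ)
  rw [h]
  exact K.sub_mem (key hW' _) (key hW _)

/-- The chart `φ` carries the tangent subspaces `D` to the constant subspace `K` of the model
space. -/
def IsStraightenedBy (D : TangentSubspaces I N) (φ : OpenPartialHomeomorph N H)
    (K : Submodule ℝ V) : Prop :=
  ∀ y ∈ φ.source, ∀ v : TangentSpace I y, v ∈ D y ↔ (mfderiv I I φ y v : V) ∈ K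

variable {φ : OpenPartialHomeomorph N H}

theorem contMDiffAt_extend_symm [I.Boundaryless] (hφ : φ ∈ IsManifold.maximalAtlas I ∞ N) {x : V}
    (hx : x ∈ (φ.extend I).target) : ContMDiffAt 𝓘(ℝ, V) I ∞ (φ.extend I).symm x := by
  have := contMDiffOn_extend_symm hφ
  refine this.contMDiffAt ?_
  have h2 := φ.isOpen_extend_target (I := I)
  rw [φ.extend_target'] at h2 hx
  exact h2.mem_nhds hx

theorem mfderiv_extend (hφ : φ ∈ IsManifold.maximalAtlas I ∞ N) {y : N} (hy : y ∈ φ.source) :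
    mfderiv I 𝓘(ℝ, V) (φ.extend I) y = mfderiv I I φ y := by
  have h := I.hasMFDerivAt.comp y
    ((contMDiffAt_of_mem_maximalAtlas hφ hy).mdifferentiableAt (by simp)).hasMFDerivAt
  exact h.mfderiv.trans (ContinuousLinearMap.id_comp _)

variable [I.Boundaryless]

/-- The derivatives of a chart of the smooth structure and of its inverse are inverse to each
other. -/
theorem mfderiv_extend_symm_inverse (hφ : φ ∈ IsManifold.maximalAtlas I ∞ N) {x : V}
    (hx : x ∈ (φ.extend I).target) :
    (mfderiv 𝓘(ℝ, V) I (φ.extend I).symm x).IsInvertible ∧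
    (mfderiv 𝓘(ℝ, V) I (φ.extend I).symm x).inverse = mfderiv I I φ ((φ.extend I).symm x) := by
  set y := (φ.extend I).symm x with hy
  have hys : y ∈ φ.source := by
    have := (φ.extend I).map_target hx
    rwa [φ.extend_source] at this
  have hxy : φ.extend I y = x := (φ.extend I).right_inv hx
  have h1 : MDifferentiableAt 𝓘(ℝ, V) I (φ.extend I).symm x :=
    (contMDiffAt_extend_symm hφ hx).mdifferentiableAt (by simp)
  have h2 : MDifferentiableAt I 𝓘(ℝ, V) (φ.extend I) y :=
    (φ.contMDiffAt_extend hφ hys).mdifferentiableAt (by simp)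
  have e1 : (mfderiv I 𝓘(ℝ, V) (φ.extend I) y).comp
      (mfderiv 𝓘(ℝ, V) I (φ.extend I).symm x) = ContinuousLinearMap.id ℝ V := by
    rw [← mfderiv_comp x h2 h1]
    have : (φ.extend I) ∘ (φ.extend I).symm =ᶠ[𝓝 x] id := by
      filter_upwards [(φ.isOpen_extend_target (I := I)).mem_nhds hx] with z hz
      exact (φ.extend I).right_inv hz
    rw [this.mfderiv_eq, mfderiv_id]
    rfl
  have e2 : (mfderiv 𝓘(ℝ, V) I (φ.extend I).symm x).comp
      (mfderiv I 𝓘(ℝ, V) (φ.extend I) y) = ContinuousLinearMap.id ℝ V := by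
    have h1' : MDifferentiableAt 𝓘(ℝ, V) I (φ.extend I).symm (φ.extend I y) := by rwa [hxy]
    have e3 := mfderiv_comp y h1' h2
    have : (φ.extend I).symm ∘ (φ.extend I) =ᶠ[𝓝 y] id := by
      filter_upwards [φ.open_source.mem_nhds hys] with z hz
      exact (φ.extend I).left_inv (by rwa [φ.extend_source])
    rw [this.mfderiv_eq, mfderiv_id] at e3
    rw [hxy] at e3
    exact e3.symm
  rw [mfderiv_extend hφ hys] at e1 e2
  exact ⟨.of_inverse e2 e1, ContinuousLinearMap.inverse_eq e2 e1⟩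

theorem mfderiv_extend_isInvertible (hφ : φ ∈ IsManifold.maximalAtlas I ∞ N) {y : N}
    (hy : y ∈ φ.source) : (mfderiv I 𝓘(ℝ, V) (φ.extend I) y).IsInvertible := by
  have hx : φ.extend I y ∈ (φ.extend I).target :=
    (φ.extend I).map_source (by rwa [φ.extend_source])
  have h := mfderiv_extend_symm_inverse hφ hx
  rw [φ.extend_left_inv hy] at h
  rw [mfderiv_extend hφ hy]
  obtain ⟨⟨A, hA⟩, h2⟩ := h
  rw [← hA, ContinuousLinearMap.inverse_equiv] at h2
  exact ⟨A.symm, h2⟩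

variable [IsManifold I ∞ N] [FiniteDimensional ℝ V] {D : TangentSubspaces I N}

/-- The easy half of Frobenius' theorem: in a straightening chart, sections of `D` become vector
fields with values in a constant subspace, and pulling back commutes with the bracket. -/
theorem IsIntegrableDistribution.isInvolutive (hD : IsIntegrableDistribution D) :
    IsInvolutive D := by
  have : CompleteSpace V := FiniteDimensional.complete ℝ V
  have : IsManifold I (minSmoothness ℝ 2) N := by
    rw [minSmoothness_of_isRCLikeNormedField]; infer_instance
  intro U hU S S' hS hS' hSD hSD' y hy
  obtain ⟨φ, hφ, hyφ, K, hK⟩ := hD y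
  obtain ⟨x, hx, rfl⟩ : ∃ x ∈ (φ.extend I).target, (φ.extend I).symm x = y :=
    ⟨φ.extend I y, (φ.extend I).map_source (by rwa [φ.extend_source]), φ.extend_left_inv hyφ⟩
  have hσ := contMDiffAt_extend_symm hφ hx
  have hUx : U ∈ 𝓝 ((φ.extend I).symm x) := hU.mem_nhds hy
  have hb := VectorField.mpullback_mlieBracket (n := ∞)
    ((hS.contMDiffAt hUx).mdifferentiableAt (by simp))
    ((hS'.contMDiffAt hUx).mdifferentiableAt (by simp)) hσ
    (by rw [minSmoothness_of_isRCLikeNormedField]; exact ENat.LEInfty.out)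
  -- in the chart, a section of `D` is a vector field with values in `K`
  have key : ∀ T : (y : N) → TangentSpace I y, (∀ y ∈ U, T y ∈ D y) →
      ∀ᶠ z in 𝓝 x, (VectorField.mpullback 𝓘(ℝ, V) I (φ.extend I).symm T z : V) ∈ K := by
    intro T hT
    filter_upwards [(φ.isOpen_extend_target (I := I)).mem_nhds hx,
      hσ.continuousAt.eventually hUx] with z hz hzU
    rw [VectorField.mpullback_apply, (mfderiv_extend_symm_inverse hφ hz).2]
    refine (hK _ ?_ _).1 (hT _ hzU)
    simpa using (φ.extend I).map_target hz
  rw [VectorField.mpullback_apply, (mfderiv_extend_symm_inverse hφ hx).2] at hb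
  exact (hK _ hyφ _).2 (mem_of_eq_of_mem (s := (K : Set V)) hb
    (mlieBracket_mem K.closed_of_finiteDimensional (key S hSD) (key S' hSD')))

/-- A constant basis of the model subspace, pulled back by a straightening chart, is a smooth local
frame. -/
theorem isSmoothSubbundle_of_isStraightenedBy {k : ℕ}
    (hD : ∀ y, ∃ φ ∈ IsManifold.maximalAtlas I ∞ N, y ∈ φ.source ∧
      ∃ K : Submodule ℝ V, Module.finrank ℝ K = k ∧ IsStraightenedBy D φ K) :
    IsSmoothSubbundle k D := by
  have : CompleteSpace V := FiniteDimensional.complete ℝ V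
  intro y
  obtain ⟨φ, hφ, hyφ, K, hk, hK⟩ := hD y
  let b := Module.finBasisOfFinrankEq ℝ K hk
  let c : V → (x : V) → TangentSpace 𝓘(ℝ, V) x := fun w _ => w
  refine ⟨φ.source, φ.open_source, hyφ,
    fun i => VectorField.mpullback I 𝓘(ℝ, V) (φ.extend I) (c (b i)), fun i z hz => ?_,
    fun z hz => ?_⟩
  · refine (ContMDiffAt.mpullback_vectorField_preimage (n := ∞) ?_ (φ.contMDiffAt_extend hφ hz)
      (mfderiv_extend_isInvertible hφ hz) (by simp)).contMDiffWithinAt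
    exact contMDiffAt_vectorSpace_iff_contDiffAt.2 contDiffAt_const
  · obtain ⟨A, hA⟩ : ∃ A : V ≃L[ℝ] V, (A : V →L[ℝ] V) = mfderiv I 𝓘(ℝ, V) (φ.extend I) z :=
      mfderiv_extend_isInvertible hφ hz
    have hS : (fun i => VectorField.mpullback I 𝓘(ℝ, V) (φ.extend I) (c (b i)) z)
        = fun i => A.symm (b i : V) := by
      funext i
      have : (mfderiv I 𝓘(ℝ, V) (φ.extend I) z).inverse = (A.symm : V →L[ℝ] V) := by
        rw [← hA]; exact ContinuousLinearMap.inverse_equiv A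
      rw [VectorField.mpullback_apply, this]
      rfl
    have hDz : D z = K.map (A.symm : V →ₗ[ℝ] V) := by
      have h1 : ∀ v : TangentSpace I z, v ∈ D z ↔ A v ∈ K := by
        intro v
        rw [hK z hz v, ← mfderiv_extend hφ hz, ← hA]
        rfl
      ext v
      rw [h1]
      constructor
      · exact fun h => ⟨_, h, A.symm_apply_apply v⟩
      · rintro ⟨w, hw, rfl⟩
        simpa using hw
    rw [hS]
    constructor
    · have h1 : LinearIndependent ℝ (fun i => (b i : V)) :=
        b.linearIndependent.map' K.subtype K.ker_subtype
      exact h1.map' (A.symm : V →ₗ[ℝ] V) (LinearEquiv.ker A.symm.toLinearEquiv)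
    · have h2 : Submodule.span ℝ (range fun i => (b i : V)) = K := by
        have := congrArg (Submodule.map K.subtype) b.span_eq
        rwa [Submodule.map_span, ← range_comp, Submodule.map_top, K.range_subtype] at this
      have h3 := Submodule.map_span (A.symm : V →ₗ[ℝ] V) (range fun i => (b i : V))
      rw [h2, ← range_comp] at h3
      rw [hDz, h3]
      rfl

end Charts

/-! ### Smoothness of maps on the target of a covering -/

section Descent

variable {V : Type*} [NormedAddCommGroup V] [NormedSpace ℝ V]
  {H : Type*} [TopologicalSpace H] {I : ModelWithCorners ℝ V H}
  {M : Type*} [TopologicalSpace M] [ChartedSpace H M]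
  {N : Type*} [TopologicalSpace N]

/-- Pointwise version of `HasSmoothDeck.contMDiff_of_comp`, for maps that are smooth on a part of
the quotient only. -/
theorem HasSmoothDeck.contMDiffAt_of_comp [IsManifold I ∞ M] {f : M → N} (hd : HasSmoothDeck I f)
    (hf : IsLocalHomeomorph f) (hs : Function.Surjective f)
    {V' : Type*} [NormedAddCommGroup V'] [NormedSpace ℝ V']
    {H' : Type*} [TopologicalSpace H'] {I' : ModelWithCorners ℝ V' H'}
    {N' : Type*} [TopologicalSpace N'] [ChartedSpace H' N'] {h : N → N'} {a : M} :
    letI := hf.chartedSpace (H := H) hs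
    ContMDiffAt I I' ∞ (h ∘ f) a → ContMDiffAt I I' ∞ h (f a) := by
  let _ := hf.chartedSpace (H := H) hs
  intro hh
  have := hd.isManifold hf hs
  set q := f a
  set g := hs.hasRightInverse.choose
  -- the chart of the quotient at `q` factors through the chart of `M` at `g q`
  let σ : N → M := fun y => (chartAt H (g q)).symm (chartAt H q y)
  have hσ : ContMDiffAt I I ∞ σ q := by
    refine ContMDiffAt.comp (I' := I) (M' := H) q ?_ ?_
    · exact (contMDiffOn_chart_symm (I := I) (n := ∞)).contMDiffAt
        ((chartAt H (g q)).open_target.mem_nhds (mem_chart_target H q).1)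
    · exact (contMDiffOn_chart (I := I) (n := ∞)).contMDiffAt
        ((chartAt H q).open_source.mem_nhds (mem_chart_source H q))
  have hfσ : ∀ y ∈ (chartAt H q).source, f (σ y) = y := by
    intro y hy
    have := (chartAt H q).left_inv hy
    change (hf.localInverseAt (g q)).symm _ = y at this
    rwa [hf.localInverseAt_symm] at this
  -- a deck transformation moves the lift of `q` that the chart provides to `a`
  obtain ⟨s, hs1, hs2, hs3⟩ := hd (σ q) a (hfσ q (mem_chart_source H q))
  have h1 : ContMDiffAt I I' ∞ (h ∘ f) (s (σ q)) := by rwa [hs2]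
  refine (h1.comp q (hs1.comp q hσ)).congr_of_eventuallyEq ?_
  filter_upwards [(chartAt H q).open_source.mem_nhds (mem_chart_source H q),
    hσ.continuousAt.eventually hs3] with y hy h2
  change h y = h (f (s (σ y)))
  rw [h2, hfσ y hy]

end Descent

/-! ### Local trivializations of the associated bundle -/

namespace IsPrincipalBundle

open MulOpposite

variable {d : ℕ} {Γ : CrystallographicGroup d}
  {E : Type*} [NormedAddCommGroup E] [NormedSpace ℝ E]
  {X : Type*} [TopologicalSpace X] [ChartedSpace E X]
  {Q : Type*} [TopologicalSpace Q] [ChartedSpace E Q] [MulAction Γ.PointGroupᵐᵒᵖ Q]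
  {π : Q → X}

theorem exists_localSection (hQ : IsPrincipalBundle Γ E π) (x : X) :
    ∃ z : SmoothLocalSection E π, x ∈ z.dom := by
  obtain ⟨e, hx, -, he⟩ := hQ.locally_trivial x
  exact ⟨⟨e.baseSet, e.open_baseSet, fun x => e.toOpenPartialHomeomorph.symm (x, 1), he 1,
    fun x hx => e.proj_symm_apply' hx⟩, hx⟩

/-- A local section through `q₀` inverts `π` near `q₀`: the fibres are discrete. -/
theorem eventually_section_proj_eq (hQ : IsPrincipalBundle Γ E π) (z : SmoothLocalSection E π)
    {q₀ : Q} (hq₀ : π q₀ ∈ z.dom) (h : z.toFun (π q₀) = q₀) :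
    ∀ᶠ q in 𝓝 q₀, z.toFun (π q) = q := by
  obtain ⟨e, hx, -, -⟩ := hQ.locally_trivial (π q₀)
  have hπ : ContinuousAt π q₀ := hQ.contMDiff_proj.continuous.continuousAt
  have hs : q₀ ∈ e.source := e.mem_source.2 hx
  have hdom : ∀ᶠ q in 𝓝 q₀, π q ∈ z.dom := hπ.eventually (z.isOpen_dom.mem_nhds hq₀)
  have hz : ContinuousAt (fun q => z.toFun (π q)) q₀ :=
    ContinuousAt.comp (g := z.toFun)
      (z.contMDiffOn.continuousOn.continuousAt (z.isOpen_dom.mem_nhds hq₀)) hπ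
  have h2 : ∀ {q : Q}, q ∈ e.source → ContinuousAt (fun q => (e q).2) q := fun hq =>
    continuous_snd.continuousAt.comp (e.toOpenPartialHomeomorph.continuousAt hq)
  have h3 : ContinuousAt (fun q => (e (z.toFun (π q))).2) q₀ :=
    ContinuousAt.comp (g := fun q => (e q).2) (h2 (by rwa [h])) hz
  -- the fibre coordinates of `z (π q)` and of `q` are locally constant, as `P` is discrete
  filter_upwards [hdom, e.open_source.mem_nhds hs,
    h3.eventually ((isOpen_discrete {(e q₀).2}).mem_nhds (by simp [h])),
    (h2 hs).eventually ((isOpen_discrete {(e q₀).2}).mem_nhds rfl)] with q hq hqs hq1 hq2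
  have hzs : z.toFun (π q) ∈ e.source := by
    rw [e.mem_source, z.proj_toFun _ hq]
    exact e.mem_source.1 hqs
  refine e.injOn hzs hqs (Prod.ext ?_ ?_)
  · change (e _).1 = (e _).1
    rw [e.coe_fst hzs, e.coe_fst hqs, z.proj_toFun _ hq]
  · exact (mem_singleton_iff.1 hq1).trans (mem_singleton_iff.1 hq2).symm

variable (hQ : IsPrincipalBundle Γ E π)

theorem continuous_proj : Continuous hQ.proj :=
  hQ.isQuotientMap_cls.continuous_iff.2 (hQ.contMDiff_proj.continuous.comp continuous_fst)

/-- The transition functions are locally constant: near each point, the torus coordinates of two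
local trivializations differ by a fixed `ρ(p)`. -/
theorem localTriv_snd_eventuallyEq (z z' : SmoothLocalSection E π) {y : hQ.Assoc}
    (hy : hQ.proj y ∈ z.dom) (hy' : hQ.proj y ∈ z'.dom) :
    ∃ p : Γ.PointGroup,
      (fun w => (hQ.localTriv z' w).2) =ᶠ[𝓝 y] fun w => Γ.rho p (hQ.localTriv z w).2 := by
  obtain ⟨p, hp⟩ := hQ.exists_smul_eq (q := z.toFun (hQ.proj y)) (q' := z'.toFun (hQ.proj y))
    ((z.proj_toFun _ hy).trans (z'.proj_toFun _ hy').symm)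
  refine ⟨p⁻¹, ?_⟩
  have h1 : ∀ᶠ x in 𝓝 (hQ.proj y), z'.toFun x = op p • z.toFun x := by
    have hc : ContinuousAt (fun x => op p • z.toFun x) (hQ.proj y) :=
      ContinuousAt.comp (g := fun q : Q => op p • q)
        (hQ.contMDiff_smul p).continuous.continuousAt
        (z.contMDiffOn.continuousOn.continuousAt (z.isOpen_dom.mem_nhds hy))
    have hπp : π (op p • z.toFun (hQ.proj y)) = hQ.proj y := by
      rw [hQ.proj_smul, z.proj_toFun _ hy]
    -- the translate of `z` by `p` lies on `z'` near `π_Y y`, as it does at that point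
    filter_upwards [hc.eventually (hQ.eventually_section_proj_eq z' (by rwa [hπp])
      (by rw [hπp]; exact hp.symm)), z.isOpen_dom.mem_nhds hy] with x hx hxd
    rwa [hQ.proj_smul, z.proj_toFun _ hxd] at hx
  filter_upwards [hQ.continuous_proj.continuousAt.eventually h1,
    hQ.continuous_proj.continuousAt.eventually (z.isOpen_dom.mem_nhds hy),
    hQ.continuous_proj.continuousAt.eventually (z'.isOpen_dom.mem_nhds hy')] with w hw hwd hwd'
  obtain ⟨τ, hτ⟩ := hQ.exists_fiberCoord z w hwd
  have e1 : hQ.localTriv z w = (hQ.proj w, τ) := by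
    conv_lhs => rw [← hτ]
    exact hQ.localTriv_cls z hwd τ
  have e2 : hQ.cls (z'.toFun (hQ.proj w), Γ.rho p⁻¹ τ) = w := by
    conv_rhs => rw [← hτ]
    exact (hQ.cls_eq.2 ⟨p, by rw [hw]⟩).symm
  have e3 : hQ.localTriv z' w = (hQ.proj w, Γ.rho p⁻¹ τ) := by
    conv_lhs => rw [← e2]
    exact hQ.localTriv_cls z' hwd' _
  rw [e1, e3]

variable [IsManifold 𝓘(ℝ, E) ∞ Q]

theorem contMDiffOn_localTriv (z : SmoothLocalSection E π) :
    ContMDiffOn (𝓘(ℝ, E).prod 𝓘(ℝ, EuclideanSpace ℝ (Fin d)))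
      (𝓘(ℝ, E).prod 𝓘(ℝ, EuclideanSpace ℝ (Fin d))) ∞ (hQ.localTriv z)
      (hQ.proj ⁻¹' z.dom) := by
  intro y hy
  obtain ⟨τ, hτ⟩ := hQ.exists_fiberCoord z y hy
  set a : Q × Γ.Torus := (z.toFun (hQ.proj y), τ) with ha
  have hπa : π a.1 = hQ.proj y := z.proj_toFun _ hy
  have h1 : ContMDiffAt (𝓘(ℝ, E).prod 𝓘(ℝ, EuclideanSpace ℝ (Fin d)))
      (𝓘(ℝ, E).prod 𝓘(ℝ, EuclideanSpace ℝ (Fin d))) ∞ (hQ.localTriv z ∘ hQ.cls) a := by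
    have h2 : ContMDiffAt (𝓘(ℝ, E).prod 𝓘(ℝ, EuclideanSpace ℝ (Fin d)))
      (𝓘(ℝ, E).prod 𝓘(ℝ, EuclideanSpace ℝ (Fin d))) ∞
      (fun b : Q × Γ.Torus => (π b.1, b.2)) a :=
      ((hQ.contMDiff_proj.comp contMDiff_fst).prodMk contMDiff_snd).contMDiffAt
    refine h2.congr_of_eventuallyEq ?_
    have h3 := hQ.eventually_section_proj_eq z (q₀ := a.1) (by rwa [hπa]) (by rw [hπa])
    have hd : ∀ᶠ b : Q × Γ.Torus in 𝓝 a, π b.1 ∈ z.dom :=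
      (hQ.contMDiff_proj.continuous.comp continuous_fst).continuousAt.eventually
        (z.isOpen_dom.mem_nhds (by change π a.1 ∈ _; rwa [hπa]))
    filter_upwards [continuous_fst.continuousAt.eventually h3, hd] with b hb hbd
    have := hQ.localTriv_cls z hbd b.2
    rwa [hb] at this
  have h4 := hQ.hasSmoothDeck_cls.contMDiffAt_of_comp hQ.isLocalHomeomorph_cls
    hQ.cls_surjective h1
  rw [hτ] at h4
  exact h4.contMDiffWithinAt

theorem contMDiffOn_cls_section (z : SmoothLocalSection E π) :
    ContMDiffOn (𝓘(ℝ, E).prod 𝓘(ℝ, EuclideanSpace ℝ (Fin d)))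
      (𝓘(ℝ, E).prod 𝓘(ℝ, EuclideanSpace ℝ (Fin d))) ∞
      (fun a : X × Γ.Torus => hQ.cls (z.toFun a.1, a.2)) (z.dom ×ˢ univ) := by
  have h1 := hQ.hasSmoothDeck_cls.contMDiff hQ.isLocalHomeomorph_cls hQ.cls_surjective
  refine h1.comp_contMDiffOn ?_
  exact (z.contMDiffOn.comp contMDiffOn_fst fun a ha => ha.1).prodMk contMDiffOn_snd

/-- The local trivialization over the domain of a section `z`, with inverse
`(x, τ) ↦ [z x, τ]`. -/
noncomputable def trivHomeomorph (z : SmoothLocalSection E π) :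
    OpenPartialHomeomorph hQ.Assoc (X × Γ.Torus) where
  toFun := hQ.localTriv z
  invFun a := hQ.cls (z.toFun a.1, a.2)
  source := hQ.proj ⁻¹' z.dom
  target := z.dom ×ˢ univ
  map_source' y hy := ⟨hy, mem_univ _⟩
  map_target' a ha := by
    change π (z.toFun a.1) ∈ z.dom
    rw [z.proj_toFun _ ha.1]
    exact ha.1
  left_inv' y hy := by
    obtain ⟨τ, hτ⟩ := hQ.exists_fiberCoord z y hy
    have := hQ.localTriv_cls z hy τ
    rw [hτ] at this
    rw [this, hτ]
  right_inv' a ha := hQ.localTriv_cls z ha.1 a.2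
  open_source := z.isOpen_dom.preimage hQ.continuous_proj
  open_target := z.isOpen_dom.prod isOpen_univ
  continuousOn_toFun := (hQ.contMDiffOn_localTriv z).continuousOn
  continuousOn_invFun := (hQ.contMDiffOn_cls_section z).continuousOn

theorem mdifferentiableAt_localTriv (z : SmoothLocalSection E π) {y : hQ.Assoc}
    (hy : hQ.proj y ∈ z.dom) :
    MDifferentiableAt (𝓘(ℝ, E).prod 𝓘(ℝ, EuclideanSpace ℝ (Fin d)))
      (𝓘(ℝ, E).prod 𝓘(ℝ, EuclideanSpace ℝ (Fin d))) (hQ.localTriv z) y :=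
  ((hQ.contMDiffOn_localTriv z).contMDiffAt
    ((z.isOpen_dom.preimage hQ.continuous_proj).mem_nhds hy)).mdifferentiableAt (by simp)

theorem mfderiv_localTriv_bijective (z : SmoothLocalSection E π) {y : hQ.Assoc}
    (hy : hQ.proj y ∈ z.dom) :
    Function.Bijective (mfderiv (𝓘(ℝ, E).prod 𝓘(ℝ, EuclideanSpace ℝ (Fin d)))
      (𝓘(ℝ, E).prod 𝓘(ℝ, EuclideanSpace ℝ (Fin d))) (hQ.localTriv z) y) := by
  have h : (hQ.trivHomeomorph z).MDifferentiable (𝓘(ℝ, E).prod 𝓘(ℝ, EuclideanSpace ℝ (Fin d)))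
      (𝓘(ℝ, E).prod 𝓘(ℝ, EuclideanSpace ℝ (Fin d))) :=
    ⟨(hQ.contMDiffOn_localTriv z).mdifferentiableOn (by simp),
      (hQ.contMDiffOn_cls_section z).mdifferentiableOn (by simp)⟩
  exact h.mfderiv_bijective hy

theorem mfderiv_localTriv_fst (z : SmoothLocalSection E π) {y : hQ.Assoc}
    (hy : hQ.proj y ∈ z.dom)
    (v : TangentSpace (𝓘(ℝ, E).prod 𝓘(ℝ, EuclideanSpace ℝ (Fin d))) y) :
    (mfderiv (𝓘(ℝ, E).prod 𝓘(ℝ, EuclideanSpace ℝ (Fin d)))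
      (𝓘(ℝ, E).prod 𝓘(ℝ, EuclideanSpace ℝ (Fin d))) (hQ.localTriv z) y v :
        E × EuclideanSpace ℝ (Fin d)).1
      = mfderiv (𝓘(ℝ, E).prod 𝓘(ℝ, EuclideanSpace ℝ (Fin d))) 𝓘(ℝ, E) hQ.proj y v := by
  have h := (hasMFDerivAt_fst (I := 𝓘(ℝ, E)) (I' := 𝓘(ℝ, EuclideanSpace ℝ (Fin d)))
    (x := hQ.localTriv z y)).comp y (hQ.mdifferentiableAt_localTriv z hy).hasMFDerivAt
  exact (congrArg (fun A => A v) h.mfderiv).symm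

theorem mfderiv_localTriv_snd (z : SmoothLocalSection E π) {y : hQ.Assoc}
    (hy : hQ.proj y ∈ z.dom)
    (v : TangentSpace (𝓘(ℝ, E).prod 𝓘(ℝ, EuclideanSpace ℝ (Fin d))) y) :
    (mfderiv (𝓘(ℝ, E).prod 𝓘(ℝ, EuclideanSpace ℝ (Fin d)))
      (𝓘(ℝ, E).prod 𝓘(ℝ, EuclideanSpace ℝ (Fin d))) (hQ.localTriv z) y v :
        E × EuclideanSpace ℝ (Fin d)).2
      = mfderiv (𝓘(ℝ, E).prod 𝓘(ℝ, EuclideanSpace ℝ (Fin d))) 𝓘(ℝ, EuclideanSpace ℝ (Fin d))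
        (fun w => (hQ.localTriv z w).2) y v := by
  have h := (hasMFDerivAt_snd (I := 𝓘(ℝ, E)) (I' := 𝓘(ℝ, EuclideanSpace ℝ (Fin d)))
    (x := hQ.localTriv z y)).comp y (hQ.mdifferentiableAt_localTriv z hy).hasMFDerivAt
  exact (congrArg (fun A => A v) h.mfderiv).symm

/-! ### The local horizontal spaces -/

/-- The local horizontal space is the kernel of the derivative of the torus coordinate. -/
theorem mem_localHorizontal_iff (z : SmoothLocalSection E π) {y : hQ.Assoc}
    (hy : hQ.proj y ∈ z.dom)
    (v : TangentSpace (𝓘(ℝ, E).prod 𝓘(ℝ, EuclideanSpace ℝ (Fin d))) y) :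
    v ∈ hQ.localHorizontal z y ↔
      mfderiv (𝓘(ℝ, E).prod 𝓘(ℝ, EuclideanSpace ℝ (Fin d))) 𝓘(ℝ, EuclideanSpace ℝ (Fin d))
        (fun w => (hQ.localTriv z w).2) y v = 0 := by
  rw [← hQ.mfderiv_localTriv_snd z hy]
  exact ⟨fun h => h.2, fun h => ⟨trivial, h⟩⟩

theorem localHorizontal_le (z z' : SmoothLocalSection E π) {y : hQ.Assoc}
    (hy : hQ.proj y ∈ z.dom) (hy' : hQ.proj y ∈ z'.dom) :
    hQ.localHorizontal z y ≤ hQ.localHorizontal z' y := by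
  intro v hv
  rw [hQ.mem_localHorizontal_iff z hy] at hv
  rw [hQ.mem_localHorizontal_iff z' hy']
  obtain ⟨p, hp⟩ := hQ.localTriv_snd_eventuallyEq z z' hy hy'
  have h1 : MDifferentiableAt (𝓘(ℝ, E).prod 𝓘(ℝ, EuclideanSpace ℝ (Fin d)))
      𝓘(ℝ, EuclideanSpace ℝ (Fin d)) (fun w => (hQ.localTriv z w).2) y :=
    mdifferentiableAt_snd.comp y (hQ.mdifferentiableAt_localTriv z hy)
  have h2 := ((Γ.contMDiff_rho p).mdifferentiable (by simp) _).hasMFDerivAt.comp y h1.hasMFDerivAt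
  have h3 := hp.mfderiv_eq (I := 𝓘(ℝ, E).prod 𝓘(ℝ, EuclideanSpace ℝ (Fin d)))
    (I' := 𝓘(ℝ, EuclideanSpace ℝ (Fin d)))
  have h4 := congrArg (fun A => A v) (h3.trans h2.mfderiv)
  refine h4.trans ?_
  change mfderiv _ _ (Γ.rho p) _ (mfderiv _ _ (fun w => (hQ.localTriv z w).2) y v) = 0
  rw [hv]
  exact map_zero _

theorem localHorizontal_eq (z z' : SmoothLocalSection E π) {y : hQ.Assoc}
    (hy : hQ.proj y ∈ z.dom) (hy' : hQ.proj y ∈ z'.dom) :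
    hQ.localHorizontal z y = hQ.localHorizontal z' y :=
  le_antisymm (hQ.localHorizontal_le z z' hy hy') (hQ.localHorizontal_le z' z hy' hy)

theorem isCompl_localHorizontal (z : SmoothLocalSection E π) {y : hQ.Assoc}
    (hy : hQ.proj y ∈ z.dom) :
    IsCompl (hQ.localHorizontal z y) (verticalSpaces 𝓘(ℝ, E) hQ.proj y) := by
  obtain ⟨hinj, hsurj⟩ := hQ.mfderiv_localTriv_bijective z hy
  have hH := hQ.mem_localHorizontal_iff z hy
  have hV : ∀ v, v ∈ verticalSpaces 𝓘(ℝ, E) hQ.proj y ↔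
      mfderiv (𝓘(ℝ, E).prod 𝓘(ℝ, EuclideanSpace ℝ (Fin d))) 𝓘(ℝ, E) hQ.proj y v = 0 :=
    fun v => Iff.rfl
  constructor
  · rw [Submodule.disjoint_def]
    intro v h1 h2
    rw [hH, ← hQ.mfderiv_localTriv_snd z hy] at h1
    rw [hV, ← hQ.mfderiv_localTriv_fst z hy] at h2
    exact hinj ((Prod.ext h2 h1 : (_ : E × EuclideanSpace ℝ (Fin d)) = 0).trans (map_zero _).symm)
  · rw [codisjoint_iff_le_sup]
    intro v _
    obtain ⟨u, hu⟩ := hsurj ((mfderiv (𝓘(ℝ, E).prod 𝓘(ℝ, EuclideanSpace ℝ (Fin d))) 𝓘(ℝ, E)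
      hQ.proj y v, 0) : E × EuclideanSpace ℝ (Fin d))
    have hu1 : u ∈ hQ.localHorizontal z y := by
      rw [hH, ← hQ.mfderiv_localTriv_snd z hy, hu]
      rfl
    have hu2 : v - u ∈ verticalSpaces 𝓘(ℝ, E) hQ.proj y := by
      rw [hV, map_sub, ← hQ.mfderiv_localTriv_fst z hy u, hu]
      exact sub_self _
    exact Submodule.mem_sup.2 ⟨u, hu1, v - u, hu2, add_sub_cancel _ _⟩

/-- The canonical connection: the horizontal space at `y` is the one given by any local section
defined at the base point of `y`. -/
noncomputable def horizontal :
    TangentSubspaces (𝓘(ℝ, E).prod 𝓘(ℝ, EuclideanSpace ℝ (Fin d))) hQ.Assoc :=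
  fun y => hQ.localHorizontal (hQ.exists_localSection (hQ.proj y)).choose y

theorem horizontal_eq (z : SmoothLocalSection E π) {y : hQ.Assoc} (hy : hQ.proj y ∈ z.dom) :
    hQ.horizontal y = hQ.localHorizontal z y :=
  hQ.localHorizontal_eq _ z (hQ.exists_localSection (hQ.proj y)).choose_spec hy

end IsPrincipalBundle

/-! ### Straightening charts for the horizontal spaces -/

namespace IsPrincipalBundle

variable {d : ℕ} {Γ : CrystallographicGroup d}
  {E : Type*} [NormedAddCommGroup E] [NormedSpace ℝ E]
  {X : Type*} [TopologicalSpace X] [ChartedSpace E X] [IsManifold 𝓘(ℝ, E) ∞ X]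
  {Q : Type*} [TopologicalSpace Q] [ChartedSpace E Q] [IsManifold 𝓘(ℝ, E) ∞ Q]
  [MulAction Γ.PointGroupᵐᵒᵖ Q] {π : Q → X} (hQ : IsPrincipalBundle Γ E π)

/-- The chart of `Y_Π` obtained from the product chart of `X × T_Π` at `a` through the local
trivialization given by the section `z`. -/
noncomputable def trivChart (z : SmoothLocalSection E π) (a : X × Γ.Torus) :
    OpenPartialHomeomorph hQ.Assoc (ModelProd E (EuclideanSpace ℝ (Fin d))) :=
  (hQ.trivHomeomorph z).trans (chartAt (ModelProd E (EuclideanSpace ℝ (Fin d))) a)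

theorem trivChart_mem_maximalAtlas (z : SmoothLocalSection E π) (a : X × Γ.Torus) :
    hQ.trivChart z a ∈
      IsManifold.maximalAtlas (𝓘(ℝ, E).prod 𝓘(ℝ, EuclideanSpace ℝ (Fin d))) ∞ hQ.Assoc := by
  refine mem_maximalAtlas_of_contMDiffOn ?_ ?_
  · exact (contMDiffOn_chart (I := 𝓘(ℝ, E).prod 𝓘(ℝ, EuclideanSpace ℝ (Fin d))) (x := a)).comp
      ((hQ.contMDiffOn_localTriv z).mono fun y hy => hy.1) fun y hy => hy.2
  · exact (hQ.contMDiffOn_cls_section z).comp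
      ((contMDiffOn_chart_symm (I := 𝓘(ℝ, E).prod 𝓘(ℝ, EuclideanSpace ℝ (Fin d)))
        (x := a)).mono fun y hy => hy.1) fun y hy => hy.2

theorem mem_localHorizontal_iff_trivChart (z : SmoothLocalSection E π) (a : X × Γ.Torus)
    {y : hQ.Assoc} (hy : y ∈ (hQ.trivChart z a).source)
    (v : TangentSpace (𝓘(ℝ, E).prod 𝓘(ℝ, EuclideanSpace ℝ (Fin d))) y) :
    v ∈ hQ.localHorizontal z y ↔
      (mfderiv (𝓘(ℝ, E).prod 𝓘(ℝ, EuclideanSpace ℝ (Fin d)))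
        (𝓘(ℝ, E).prod 𝓘(ℝ, EuclideanSpace ℝ (Fin d))) (hQ.trivChart z a) y v :
        E × EuclideanSpace ℝ (Fin d)) ∈
        LinearMap.ker (LinearMap.snd ℝ E (EuclideanSpace ℝ (Fin d))) := by
  have hφ := hQ.trivChart_mem_maximalAtlas z a
  have hyz : hQ.proj y ∈ z.dom := hy.1
  have hya : (hQ.localTriv z y).2 ∈ (chartAt (EuclideanSpace ℝ (Fin d)) a.2).source := by
    have := hy.2
    change hQ.localTriv z y ∈ (chartAt (ModelProd E (EuclideanSpace ℝ (Fin d))) a).source at this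
    rw [prodChartedSpace_chartAt] at this
    exact this.2
  have h1 : MDifferentiableAt (𝓘(ℝ, E).prod 𝓘(ℝ, EuclideanSpace ℝ (Fin d)))
      𝓘(ℝ, EuclideanSpace ℝ (Fin d)) (fun w => (hQ.localTriv z w).2) y :=
    mdifferentiableAt_snd.comp y (hQ.mdifferentiableAt_localTriv z hyz)
  have hψ : MDifferentiableAt (𝓘(ℝ, E).prod 𝓘(ℝ, EuclideanSpace ℝ (Fin d)))
      𝓘(ℝ, E × EuclideanSpace ℝ (Fin d)) ((hQ.trivChart z a).extend
        (𝓘(ℝ, E).prod 𝓘(ℝ, EuclideanSpace ℝ (Fin d)))) y :=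
    ((hQ.trivChart z a).contMDiffAt_extend hφ hy).mdifferentiableAt (by simp)
  -- both sides compute the derivative of the torus coordinate of the chart
  have e1 := ((ContinuousLinearMap.snd ℝ E (EuclideanSpace ℝ (Fin d))).hasMFDerivAt.comp y
    hψ.hasMFDerivAt).mfderiv
  have e2 := ((mdifferentiableAt_extChartAt (I := 𝓘(ℝ, EuclideanSpace ℝ (Fin d)))
    hya).hasMFDerivAt.comp y h1.hasMFDerivAt).mfderiv
  have e3 := congrArg (fun A => A v) (e1.symm.trans e2)
  rw [mfderiv_extend hφ hy] at e3
  have hinv : Function.Injective (mfderiv 𝓘(ℝ, EuclideanSpace ℝ (Fin d))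
      𝓘(ℝ, EuclideanSpace ℝ (Fin d)) (extChartAt 𝓘(ℝ, EuclideanSpace ℝ (Fin d)) a.2)
      (hQ.localTriv z y).2) :=
    (isInvertible_mfderiv_extChartAt (I := 𝓘(ℝ, EuclideanSpace ℝ (Fin d)))
      (by rwa [extChartAt_source])).injective
  rw [hQ.mem_localHorizontal_iff z hyz]
  refine Iff.trans ?_ (Eq.congr_left e3).symm
  exact (map_eq_zero_iff _ hinv).symm

theorem exists_isStraightenedBy_horizontal (y : hQ.Assoc) :
    ∃ φ ∈ IsManifold.maximalAtlas (𝓘(ℝ, E).prod 𝓘(ℝ, EuclideanSpace ℝ (Fin d))) ∞ hQ.Assoc,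
      y ∈ φ.source ∧ IsStraightenedBy hQ.horizontal φ
        (LinearMap.ker (LinearMap.snd ℝ E (EuclideanSpace ℝ (Fin d)))) := by
  obtain ⟨z, hz⟩ := hQ.exists_localSection (hQ.proj y)
  have hy := mem_chart_source (ModelProd E (EuclideanSpace ℝ (Fin d))) (hQ.localTriv z y)
  refine ⟨hQ.trivChart z (hQ.localTriv z y), hQ.trivChart_mem_maximalAtlas _ _,
    ⟨hz, hy⟩, fun w hw v => ?_⟩
  rw [hQ.horizontal_eq z hw.1]
  exact hQ.mem_localHorizontal_iff_trivChart z _ hw v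

theorem isIntegrable_horizontal : IsIntegrableDistribution hQ.horizontal := fun y =>
  let ⟨φ, hφ, hy, h⟩ := hQ.exists_isStraightenedBy_horizontal y
  ⟨φ, hφ, hy, _, h⟩

theorem isEhresmannConnection_horizontal [FiniteDimensional ℝ E] :
    IsEhresmannConnection 𝓘(ℝ, E) hQ.proj hQ.horizontal where
  isSmoothSubbundle := isSmoothSubbundle_of_isStraightenedBy fun y =>
    let ⟨φ, hφ, hy, h⟩ := hQ.exists_isStraightenedBy_horizontal y
    ⟨φ, hφ, hy, _, by
      rw [LinearMap.ker_snd]; exact LinearMap.finrank_range_of_inj LinearMap.inl_injective, h⟩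
  isCompl _ := hQ.isCompl_localHorizontal _ (hQ.exists_localSection _).choose_spec

end IsPrincipalBundle

theorem proposition4p2 {d : ℕ} (Γ : CrystallographicGroup d)
    {E : Type*} [NormedAddCommGroup E] [NormedSpace ℝ E] [FiniteDimensional ℝ E]
    {X : Type*} [TopologicalSpace X] [ChartedSpace E X] [IsManifold 𝓘(ℝ, E) ∞ X]
    {Q : Type*} [TopologicalSpace Q] [ChartedSpace E Q] [IsManifold 𝓘(ℝ, E) ∞ Q]
    [MulAction Γ.PointGroupᵐᵒᵖ Q] {π : Q → X} (hQ : IsPrincipalBundle Γ E π) :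
    -- the local horizontal subbundles agree on overlaps
    (∀ z z' : SmoothLocalSection E π, ∀ y : hQ.Assoc, hQ.proj y ∈ z.dom → hQ.proj y ∈ z'.dom →
      hQ.localHorizontal z y = hQ.localHorizontal z' y) ∧
    -- the domains of the trivializing local sections cover the base
    (∀ x : X, ∃ z : SmoothLocalSection E π, x ∈ z.dom) ∧
    ∃ D : TangentSubspaces (𝓘(ℝ, E).prod 𝓘(ℝ, EuclideanSpace ℝ (Fin d))) hQ.Assoc,
      -- `D` restricts to all local horizontal subbundles
      hQ.IsGluing univ D ∧
      -- any cover by local sections glues to the same `D`, which thus depends only on the bundle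
      (∀ S : Set (SmoothLocalSection E π), (∀ x : X, ∃ z ∈ S, x ∈ z.dom) →
        ∀ D', hQ.IsGluing S D' → D' = D) ∧
      -- `D` is a smooth subbundle with `TY = D ⊕ VY`, and it is involutive and integrable
      IsEhresmannConnection 𝓘(ℝ, E) hQ.proj D ∧
      IsInvolutive D ∧
      IsIntegrableDistribution D := by
  refine ⟨fun z z' y => hQ.localHorizontal_eq z z', hQ.exists_localSection, hQ.horizontal,
    fun z _ y hy => hQ.horizontal_eq z hy, fun S hS D' hD' => ?_,
    hQ.isEhresmannConnection_horizontal, hQ.isIntegrable_horizontal.isInvolutive,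
    hQ.isIntegrable_horizontal⟩
  funext y
  obtain ⟨z, hzS, hz⟩ := hS (hQ.proj y)
  rw [hD' z hzS y hz, hQ.horizontal_eq z hz]
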